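/- Let $\mathbb D=\{z\in\mathbb C:|z|<1\}$. For $f$ holomorphic in $\mathbb D$ put $\widehat f_k=f^{(k)}(0)/k!$ and $\|f\|_\infty=\sup_{z\in\mathbb D}|f(z)|\in[0,\infty]$, and let $H^\infty$ be the set of all $f$ holomorphic in $\mathbb D$ with $\|f\|_\infty<\infty$. For $f,g$ holomorphic in $\mathbb D$ let $(f*g)(z)=\sum_{k=0}^\infty\widehat f_k\,\widehat g_k\,z^k$, $z\in\mathbb D$, be their Hadamard product. For $f\in H^\infty$ let $E_0(f)_\infty=\|f\|_\infty$ and, for $n\ge1$, let $E_n(f)_\infty=\inf_P\|f-P\|_\infty$, where $P$ runs over all complex algebraic polynomials of degree at most $n-1$. **Theorem.** Let $n\ge 0$ be an integer, and let $L_n$ be a holomorphic function in $\mathbb D$ such that $L_n(z)=O(z^n)$ as $z\to0$. Then $$|\widehat f_n|+\|L_n*f\|_\infty\le E_n(f)_\infty\quad\text{for all } f\in H^\infty$$ if and only if $|L_n(z)|\le\frac12|z|^{2n+1}$ for all $z\in\mathbb D$. -/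

import Mathlib

open Polynomial Topology Asymptotics
open scoped ENNReal

noncomputable section

/-- The `k`-th Taylor coefficient at the origin, `f^(k)(0) / k!`. -/
def taylorCoeff (f : ℂ → ℂ) (k : ℕ) : ℂ :=
  iteratedDeriv k f 0 / (Nat.factorial k : ℂ)

/-- The Hadamard product (convolution) of two functions holomorphic in the open unit disc:
the function whose Taylor coefficients are the products of the coefficients. The series
converges absolutely at every point of the open unit disc. -/
def hadamardProd (f g : ℂ → ℂ) (z : ℂ) : ℂ :=
  ∑' k : ℕ, taylorCoeff f k * taylorCoeff g k * z ^ k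

/-- The supremum of `|f|` over the open unit disc, as an extended nonnegative number
(it is `∞` exactly when `f` is unbounded on the disc). -/
def discSupNorm (f : ℂ → ℂ) : ℝ≥0∞ :=
  ⨆ z ∈ Metric.ball (0 : ℂ) 1, ‖f z‖ₑ

/-- The Hardy space `H^∞`: bounded holomorphic functions in the open unit disc. -/
def IsHInfty (f : ℂ → ℂ) : Prop :=
  DifferentiableOn ℂ f (Metric.ball (0 : ℂ) 1) ∧ discSupNorm f < ∞

/-- The best approximation of `f` in the supremum norm by polynomials of degree at most `n - 1`.
For `n = 0` the only polynomial of degree `< 0` is zero, and the value is the norm of `f`. -/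
def bestApprox (n : ℕ) (f : ℂ → ℂ) : ℝ≥0∞ :=
  ⨅ p ∈ Polynomial.degreeLT ℂ n, discSupNorm (fun z => f z - p.eval z)

theorem bestApprox_zero (f : ℂ → ℂ) : bestApprox 0 f = discSupNorm f := by
  have h : ∀ p : ℂ[X], p ∈ Polynomial.degreeLT ℂ 0 ↔ p = 0 := by
    intro p
    rw [Polynomial.mem_degreeLT]
    simp
  simp [bestApprox, h]

end

/-! On the circle `|ζ| = 1` the kernel `1 + 2 Re (ζ ^ (-n) u(ζ))` is nonnegative as soon as
`|u| ≤ 1 / 2`, and has mean `1` if the coefficients of `u` vanish up to index `2 n`. Integrating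
`ζ ^ n g(ζ⁻¹)` against it gives `g_n + ∑ u_k g_k`, because the conjugate term only meets
coefficients of `g` with negative index. Hence `|g_n + ∑ u_k g_k| ≤ ‖g‖_∞`; rotating `u` separates
the two moduli, and dilating turns the sum into `(L * g)(z)`. Subtracting from `g` a polynomial of
degree `< n` changes neither term, which replaces `‖g‖_∞` by the best approximation.

Conversely, already the inequality with `‖f‖_∞` on the right determines the bound on `L`. Let `B_a`
be the Blaschke factor with zero `a`. Testing on `z ^ (n - j) B_a(z ^ j)` with `a → 0` removes the
coefficients of `L` up to index `2 n`. Testing on `z ^ n B_a` with `|a| → 1` gives `|L| ≤ 1 / 2`.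
The Schwarz lemma then restores the factor `|z| ^ (2 n + 1)`. -/

open MeasureTheory Filter Set
open scoped ComplexConjugate

section TaylorCoeff

variable {f : ℂ → ℂ}

theorem hasSum_taylorCoeff (hf : DifferentiableOn ℂ f (Metric.ball 0 1)) {z : ℂ}
    (hz : ‖z‖ < 1) : HasSum (fun k => taylorCoeff f k * z ^ k) (f z) := by
  refine (Complex.hasSum_taylorSeries_on_ball hf (by simpa using hz)).congr_fun fun k => ?_
  simp only [taylorCoeff, smul_eq_mul, sub_zero]
  ring

theorem hasFPowerSeriesOnBall_of_hasSum {c : ℕ → ℂ}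
    (h : ∀ z : ℂ, ‖z‖ < 1 → HasSum (fun k => c k * z ^ k) (f z)) :
    HasFPowerSeriesOnBall f (FormalMultilinearSeries.ofScalars ℂ c) 0 1 where
  r_le := ENNReal.le_of_forall_nnreal_lt fun r hr => by
    refine FormalMultilinearSeries.le_radius_of_summable _ ?_
    have hr' : ‖((r : ℝ) : ℂ)‖ < 1 := by simpa using hr
    simpa [FormalMultilinearSeries.ofScalars_norm] using (h _ hr').summable.norm
  r_pos := one_pos
  hasSum {z} hz := by
    simpa [mul_comm] using h z (by simpa [← ofReal_norm] using hz)

theorem differentiableOn_of_hasSum {c : ℕ → ℂ}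
    (h : ∀ z : ℂ, ‖z‖ < 1 → HasSum (fun k => c k * z ^ k) (f z)) :
    DifferentiableOn ℂ f (Metric.ball 0 1) := by
  simpa [← Metric.eball_ofReal] using (hasFPowerSeriesOnBall_of_hasSum h).differentiableOn

theorem taylorCoeff_eq_of_hasSum {c : ℕ → ℂ}
    (h : ∀ z : ℂ, ‖z‖ < 1 → HasSum (fun k => c k * z ^ k) (f z)) (k : ℕ) :
    taylorCoeff f k = c k := by
  have hc := (hasFPowerSeriesOnBall_of_hasSum h).hasFPowerSeriesAt
  have := congrArg (·.coeff k) (hc.analyticAt.hasFPowerSeriesAt.eq_formalMultilinearSeries hc)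
  simpa [taylorCoeff] using this

theorem taylorCoeff_zero (f : ℂ → ℂ) : taylorCoeff f 0 = f 0 := by
  simp [taylorCoeff]

theorem taylorCoeff_polynomial_eval (p : ℂ[X]) (k : ℕ) :
    taylorCoeff (fun z => p.eval z) k = p.coeff k := by
  refine taylorCoeff_eq_of_hasSum (fun z _ => ?_) k
  rw [p.eval_eq_sum_range]
  refine hasSum_sum_of_ne_finset_zero fun j hj => ?_
  rw [p.coeff_eq_zero_of_natDegree_lt (by simpa using hj), zero_mul]

theorem taylorCoeff_sub_polynomial_eval (hf : DifferentiableOn ℂ f (Metric.ball 0 1)) (p : ℂ[X])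
    (k : ℕ) : taylorCoeff (fun z => f z - p.eval z) k = taylorCoeff f k - p.coeff k := by
  refine taylorCoeff_eq_of_hasSum (c := fun k => taylorCoeff f k - p.coeff k) (fun z hz => ?_) k
  simpa only [taylorCoeff_polynomial_eval, sub_mul] using
    (hasSum_taylorCoeff hf hz).sub (hasSum_taylorCoeff p.differentiable.differentiableOn hz)

theorem taylorCoeff_pow_mul_comp_pow (hf : DifferentiableOn ℂ f (Metric.ball 0 1)) (m : ℕ) {j : ℕ}
    (hj : j ≠ 0) (i : ℕ) :
    taylorCoeff (fun z => z ^ m * f (z ^ j)) (m + j * i) = taylorCoeff f i := by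
  have hinj : Function.Injective fun i => m + j * i := fun i i' h => by simpa [hj] using h
  rw [taylorCoeff_eq_of_hasSum
    (c := Function.extend (fun i => m + j * i) (taylorCoeff f) 0) fun z hz => ?_]
  · exact hinj.extend_apply _ _ i
  · rw [← hinj.hasSum_iff fun k hk => by simp [Function.extend_apply' _ _ _ hk]]
    have hzj : ‖z ^ j‖ < 1 := by
      rw [norm_pow]
      exact pow_lt_one₀ (norm_nonneg z) hz hj
    refine ((hasSum_taylorCoeff hf hzj).mul_left (z ^ m)).congr_fun fun i => ?_
    simp only [Function.comp_apply, hinj.extend_apply]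
    ring

theorem norm_taylorCoeff_mul_pow_le (hf : DifferentiableOn ℂ f (Metric.ball 0 1)) {r C : ℝ}
    (hr : r ∈ Ioo 0 1) (hC : ∀ z : ℂ, ‖z‖ = r → ‖f z‖ ≤ C) (k : ℕ) :
    ‖taylorCoeff f k‖ * r ^ k ≤ C := by
  have hd : DiffContOnCl ℂ f (Metric.ball 0 r) :=
    (hf.mono (Metric.closedBall_subset_ball hr.2)).diffContOnCl_ball subset_rfl
  have h := Complex.norm_iteratedDeriv_le_of_forall_mem_sphere_norm_le k hr.1 hd
    fun z hz => hC z (by simpa using hz)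
  have hk : (0 : ℝ) < k.factorial := by positivity
  rw [le_div_iff₀ (pow_pos hr.1 k)] at h
  rw [taylorCoeff, norm_div, Complex.norm_natCast, div_mul_eq_mul_div, div_le_iff₀ hk]
  linarith

theorem norm_taylorCoeff_le (hf : DifferentiableOn ℂ f (Metric.ball 0 1)) {C : ℝ}
    (hC : ∀ z ∈ Metric.ball (0 : ℂ) 1, ‖f z‖ ≤ C) (k : ℕ) : ‖taylorCoeff f k‖ ≤ C := by
  have hlim : Tendsto (fun r : ℝ => ‖taylorCoeff f k‖ * r ^ k) (𝓝[<] 1)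
      (𝓝 (‖taylorCoeff f k‖ * 1 ^ k)) :=
    tendsto_nhdsWithin_of_tendsto_nhds (Continuous.tendsto (by fun_prop) 1)
  rw [one_pow, mul_one] at hlim
  refine le_of_tendsto hlim ?_
  filter_upwards [Ioo_mem_nhdsLT (zero_lt_one' ℝ)] with r hr
  exact norm_taylorCoeff_mul_pow_le hf hr (fun z hz => hC z (by simpa [hz] using hr.2)) k

theorem taylorCoeff_eq_zero_of_norm_le_mul_pow (hf : DifferentiableOn ℂ f (Metric.ball 0 1))
    {C : ℝ} {m : ℕ} (hC : ∀ z ∈ Metric.ball (0 : ℂ) 1, ‖f z‖ ≤ C * ‖z‖ ^ m) {k : ℕ}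
    (hk : k < m) : taylorCoeff f k = 0 := by
  have hlim : Tendsto (fun r : ℝ => C * r ^ (m - k)) (𝓝[>] 0) (𝓝 (C * 0 ^ (m - k))) :=
    tendsto_nhdsWithin_of_tendsto_nhds (Continuous.tendsto (by fun_prop) 0)
  rw [zero_pow (Nat.sub_ne_zero_of_lt hk), mul_zero] at hlim
  refine norm_le_zero_iff.1 (ge_of_tendsto hlim ?_)
  filter_upwards [Ioo_mem_nhdsGT (zero_lt_one' ℝ)] with r hr
  have h := norm_taylorCoeff_mul_pow_le hf hr
    (fun z hz => (hC z (by simpa [hz] using hr.2)).trans_eq (by rw [hz])) k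
  rw [← Nat.sub_add_cancel hk.le, pow_add, ← mul_assoc] at h
  simpa using le_of_mul_le_mul_right h (pow_pos hr.1 k)

theorem isBigO_pow_of_taylorCoeff_eq_zero (hf : AnalyticAt ℂ f 0) {m : ℕ}
    (h : ∀ k < m, taylorCoeff f k = 0) : f =O[𝓝 0] fun z : ℂ => z ^ m := by
  have hder : ∀ k < m, iteratedDeriv k f 0 = 0 := fun k hk => by
    simpa [taylorCoeff, Nat.factorial_ne_zero] using h k hk
  obtain ⟨g, hg, hfg⟩ := (natCast_le_analyticOrderAt hf).1
    ((natCast_le_analyticOrderAt_iff_iteratedDeriv_eq_zero hf).2 hder)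
  have hO : (fun z : ℂ => z ^ m * g z) =O[𝓝 0] fun z : ℂ => z ^ m * 1 :=
    (isBigO_refl _ _).mul (hg.continuousAt.isBigO_one ℂ)
  simpa using hO.congr' (by filter_upwards [hfg] with z hz; simp [hz]) EventuallyEq.rfl

theorem norm_le_mul_pow_of_taylorCoeff_eq_zero (hf : DifferentiableOn ℂ f (Metric.ball 0 1))
    {C : ℝ} (hC : ∀ z ∈ Metric.ball (0 : ℂ) 1, ‖f z‖ ≤ C) {m : ℕ}
    (h : ∀ k < m, taylorCoeff f k = 0) {z : ℂ} (hz : z ∈ Metric.ball 0 1) :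
    ‖f z‖ ≤ C * ‖z‖ ^ m := by
  obtain _ | m := m
  · simpa using hC z hz
  have hf0 : f 0 = 0 := taylorCoeff_zero f ▸ h 0 m.succ_pos
  have hO := isBigO_pow_of_taylorCoeff_eq_zero (hf.analyticAt (Metric.ball_mem_nhds 0 one_pos)) h
  have ho : (fun w => f w - f 0) =o[𝓝 0] fun w : ℂ => ‖w - 0‖ ^ m := by
    simpa only [hf0, sub_zero, ← norm_pow] using
      (hO.trans_isLittleO (isLittleO_pow_pow m.lt_succ_self)).norm_right
  simpa [hf0] using Complex.dist_le_mul_div_pow_of_mapsTo_ball_of_isLittleO (R₂ := C) hf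
    (fun w hw => by simpa [hf0] using hC w hw) ho hz

end TaylorCoeff

section HadamardProd

variable {f g : ℂ → ℂ}

theorem hasSum_hadamardProd (hf : DifferentiableOn ℂ f (Metric.ball 0 1))
    (hg : DifferentiableOn ℂ g (Metric.ball 0 1)) {z : ℂ} (hz : ‖z‖ < 1) :
    HasSum (fun k => taylorCoeff f k * taylorCoeff g k * z ^ k) (hadamardProd f g z) := by
  obtain ⟨w, rfl⟩ : ∃ w, z = w * w := ⟨z ^ (1 / 2 : ℂ), by
    rw [← sq, ← Complex.cpow_nat_mul]; simp⟩
  have hw : ‖w‖ < 1 := by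
    by_contra! hw
    exact hz.not_ge (by simpa using one_le_mul_of_one_le_of_one_le hw hw)
  have hsum := summable_mul_of_summable_norm
    (hasSum_taylorCoeff hf hw).summable.norm (hasSum_taylorCoeff hg hw).summable.norm
  have hdiag : Function.Injective fun k : ℕ => (k, k) := fun k l h => congrArg Prod.fst h
  refine Summable.hasSum ((hsum.comp_injective hdiag).congr fun k => ?_)
  simp only [Function.comp_apply]
  ring

theorem differentiableOn_hadamardProd (hf : DifferentiableOn ℂ f (Metric.ball 0 1))
    (hg : DifferentiableOn ℂ g (Metric.ball 0 1)) :
    DifferentiableOn ℂ (hadamardProd f g) (Metric.ball 0 1) :=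
  differentiableOn_of_hasSum fun _ => hasSum_hadamardProd hf hg

theorem taylorCoeff_hadamardProd (hf : DifferentiableOn ℂ f (Metric.ball 0 1))
    (hg : DifferentiableOn ℂ g (Metric.ball 0 1)) (k : ℕ) :
    taylorCoeff (hadamardProd f g) k = taylorCoeff f k * taylorCoeff g k :=
  taylorCoeff_eq_of_hasSum (fun _ => hasSum_hadamardProd hf hg) k

end HadamardProd

theorem enorm_add_discSupNorm_le_ofReal_iff {c : ℂ} {f : ℂ → ℂ} {M : ℝ} (hM : 0 ≤ M) :
    ‖c‖ₑ + discSupNorm f ≤ ENNReal.ofReal M ↔ ∀ z ∈ Metric.ball (0 : ℂ) 1, ‖c‖ + ‖f z‖ ≤ M := by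
  rw [discSupNorm, ENNReal.add_biSup ⟨0, by simp⟩, iSup₂_le_iff]
  refine forall₂_congr fun z _ => ?_
  rw [← ofReal_norm, ← ofReal_norm, ← ENNReal.ofReal_add (norm_nonneg _) (norm_nonneg _),
    ENNReal.ofReal_le_ofReal_iff hM]

theorem discSupNorm_le_ofReal_iff {f : ℂ → ℂ} {M : ℝ} (hM : 0 ≤ M) :
    discSupNorm f ≤ ENNReal.ofReal M ↔ ∀ z ∈ Metric.ball (0 : ℂ) 1, ‖f z‖ ≤ M := by
  simpa using enorm_add_discSupNorm_le_ofReal_iff (c := 0) (f := f) hM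

theorem bestApprox_le_discSupNorm (n : ℕ) (f : ℂ → ℂ) : bestApprox n f ≤ discSupNorm f :=
  (iInf₂_le 0 (zero_mem _)).trans_eq (by simp)

section Integral

variable {X : Type*} [MeasurableSpace X]

theorem norm_integral_one_add_add_conj_mul_le {μ : Measure X} [IsProbabilityMeasure μ]
    {v h : X → ℂ} {M : ℝ} (hv : Integrable v μ) (hv_le : ∀ x, ‖v x‖ ≤ 1 / 2)
    (hv_zero : ∫ x, v x ∂μ = 0) (hh : ∀ x, ‖h x‖ ≤ M) :
    ‖∫ x, (1 + v x + conj (v x)) * h x ∂μ‖ ≤ M := by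
  have hre (x) : 1 + v x + conj (v x) = (1 + 2 * (v x).re : ℝ) := by
    rw [add_assoc, Complex.add_conj]
    push_cast
    ring
  have hnonneg (x) : 0 ≤ 1 + 2 * (v x).re := by
    linarith [(abs_le.1 ((Complex.abs_re_le_norm (v x)).trans (hv_le x))).1]
  have hint : Integrable (fun x => 2 * (v x).re) μ := hv.re.const_mul 2
  have hre_zero : ∫ x, (v x).re ∂μ = 0 := by
    simpa [hv_zero] using integral_re (𝕜 := ℂ) hv
  calc ‖∫ x, (1 + v x + conj (v x)) * h x ∂μ‖ ≤ ∫ x, (1 + 2 * (v x).re) * M ∂μ := by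
        refine norm_integral_le_of_norm_le (((integrable_const 1).add hint).mul_const M)
          (.of_forall fun x => ?_)
        rw [hre, norm_mul, Complex.norm_real, Real.norm_of_nonneg (hnonneg x)]
        exact mul_le_mul_of_nonneg_left (hh x) (hnonneg x)
    _ = M := by
        rw [integral_mul_const, integral_add (integrable_const 1) hint, integral_const_mul,
          hre_zero]
        simp

theorem hasSum_integral_mul [TopologicalSpace X] [CompactSpace X] [BorelSpace X]
    {μ : Measure X} [IsFiniteMeasure μ] {ι : Type*} {F : ι → C(X, ℂ)} {u : C(X, ℂ)}
    (hF : HasSum F u) (g : C(X, ℂ)) :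
    HasSum (fun i => ∫ x, F i x * g x ∂μ) (∫ x, u x * g x ∂μ) := by
  let Λ : C(X, ℂ) →L[ℝ] ℂ := L1.integralCLM.comp (ContinuousMap.toLp 1 μ ℝ)
  have hΛ (w : C(X, ℂ)) : Λ w = ∫ x, w x ∂μ := by
    rw [← integral_congr_ae (ContinuousMap.coeFn_toLp (p := 1) (𝕜 := ℝ) μ w)]
    exact (L1.integral_eq (ContinuousMap.toLp 1 μ ℝ w)).symm.trans (L1.integral_eq_integral _)
  simpa [hΛ] using (hF.mul_right g).mapL Λ

end Integral

section Fourier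

open AddCircle

theorem fourier_pow {T : ℝ} (m : ℤ) (k : ℕ) (t : AddCircle T) :
    fourier m t ^ k = fourier (m * k) t := by
  rw [fourier_apply, fourier_apply, ← Circle.coe_pow, ← toCircle_nsmul, mul_comm, mul_smul,
    natCast_zsmul]

theorem norm_fourier_apply {T : ℝ} (m : ℤ) (t : AddCircle T) : ‖fourier m t‖ = 1 :=
  Circle.norm_coe _

variable {T : ℝ} [Fact (0 < T)]

theorem integral_fourier (m : ℤ) :
    ∫ t : AddCircle T, fourier m t ∂haarAddCircle = if m = 0 then 1 else 0 := by
  have h := orthonormal_iff_ite.1 (orthonormal_fourier (T := T)) 0 m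
  rw [ContinuousMap.inner_toLp] at h
  simpa [eq_comm] using h

theorem hasSum_integral_fourier_mul {ι : Type*} {a : ι → ℂ} {m : ι → ℤ} {u : C(AddCircle T, ℂ)}
    (hu : HasSum (fun i => a i • fourier (m i)) u) (g : C(AddCircle T, ℂ)) :
    HasSum (fun i => a i * ∫ t, fourier (m i) t * g t ∂haarAddCircle)
      (∫ t, u t * g t ∂haarAddCircle) := by
  simpa only [ContinuousMap.smul_apply, smul_eq_mul, mul_assoc, integral_const_mul] using
    hasSum_integral_mul (μ := haarAddCircle) hu g

section

variable {a b : ℕ → ℂ} {u g : C(AddCircle T, ℂ)}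

theorem integral_fourier_mul (hg : HasSum (fun k : ℕ => b k • fourier (-k : ℤ)) g) (m : ℤ) :
    ∫ t, fourier m t * g t ∂haarAddCircle = if 0 ≤ m then b m.toNat else 0 := by
  have h := hasSum_integral_fourier_mul hg (fourier m)
  simp only [← fourier_add, integral_fourier, neg_add_eq_zero, mul_ite, mul_one, mul_zero] at h
  simp only [mul_comm (fourier m _)]
  refine h.unique ?_
  split_ifs with hm
  · convert hasSum_ite_eq m.toNat (b m.toNat) using 2 with k
    grind
  · convert hasSum_zero using 2 with k
    grind

theorem integral_mul_fourier_neg_eq_zero {n : ℕ}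
    (hu : HasSum (fun k : ℕ => a k • fourier (k : ℤ)) u) (ha : ∀ k ≤ n, a k = 0) :
    ∫ t, u t * fourier (-n : ℤ) t ∂haarAddCircle = 0 := by
  refine (hasSum_integral_fourier_mul hu (fourier (-n : ℤ))).unique ?_
  convert hasSum_zero using 2 with k
  rw [← integral_congr_ae (.of_forall fun t => fourier_add), integral_fourier]
  grind

theorem integral_mul_eq_tsum (hu : HasSum (fun k : ℕ => a k • fourier (k : ℤ)) u)
    (hg : HasSum (fun k : ℕ => b k • fourier (-k : ℤ)) g) :
    ∫ t, u t * g t ∂haarAddCircle = ∑' k, a k * b k := by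
  rw [← (hasSum_integral_fourier_mul hu g).tsum_eq]
  simp only [integral_fourier_mul hg, Int.natCast_nonneg, if_true, Int.toNat_natCast]

theorem integral_conj_mul_fourier_mul_eq_zero {n : ℕ}
    (hu : HasSum (fun k : ℕ => a k • fourier (k : ℤ)) u)
    (hg : HasSum (fun k : ℕ => b k • fourier (-k : ℤ)) g) (ha : ∀ k ≤ n, a k = 0) :
    ∫ t, conj (u t) * (fourier n t * g t) ∂haarAddCircle = 0 := by
  have hu_conj : HasSum (fun k : ℕ => conj (a k) • fourier (-k : ℤ)) (star u) := by
    convert hu.star using 2 with k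
    ext t
    simp only [ContinuousMap.smul_apply, ContinuousMap.star_apply, fourier_neg, smul_eq_mul,
      star_mul', RCLike.star_def]
  refine (hasSum_integral_fourier_mul hu_conj (fourier n * g)).unique ?_
  convert hasSum_zero using 2 with k
  simp only [ContinuousMap.mul_apply, ← mul_assoc, ← fourier_add, integral_fourier_mul hg]
  grind

theorem norm_coeff_add_tsum_mul_le {n : ℕ} (hu : HasSum (fun k : ℕ => a k • fourier (k : ℤ)) u)
    (hg : HasSum (fun k : ℕ => b k • fourier (-k : ℤ)) g) (ha : ∀ k ≤ 2 * n, a k = 0)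
    (hu_le : ‖u‖ ≤ 1 / 2) : ‖b n + ∑' k, a k * b k‖ ≤ ‖g‖ := by
  let v : C(AddCircle T, ℂ) := u * fourier (-n : ℤ)
  have hint {w : AddCircle T → ℂ} (hw : Continuous w) : Integrable w haarAddCircle :=
    hw.integrable_of_hasCompactSupport (.of_compactSpace _)
  have hb : ∫ t, fourier n t * g t ∂haarAddCircle = b n := by
    simp only [integral_fourier_mul hg, Int.natCast_nonneg, if_true, Int.toNat_natCast]
  have hexpand (t) : (1 + v t + conj (v t)) * (fourier n t * g t) =
      fourier n t * g t + u t * g t + conj (u t) * (fourier (2 * n : ℕ) t * g t) := by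
    have hinv : fourier (-n : ℤ) t * fourier n t = 1 := by
      rw [← fourier_add, neg_add_cancel, fourier_zero]
    have hdouble : fourier (2 * n : ℕ) t = fourier n t * fourier n t := by
      rw [← fourier_add, Nat.cast_mul, Nat.cast_two, two_mul]
    simp only [v, ContinuousMap.mul_apply, map_mul, hdouble, fourier_neg, Complex.conj_conj]
    rw [fourier_neg] at hinv
    linear_combination u t * g t * hinv
  have hkernel : ∫ t, (1 + v t + conj (v t)) * (fourier n t * g t) ∂haarAddCircle =
      b n + ∑' k, a k * b k := by
    simp only [hexpand]
    rw [integral_add, integral_add, hb, integral_mul_eq_tsum hu hg,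
      integral_conj_mul_fourier_mul_eq_zero hu hg ha, add_zero]
    all_goals exact hint (by fun_prop)
  rw [← hkernel]
  refine norm_integral_one_add_add_conj_mul_le (hint v.continuous) (fun t => ?_)
    (integral_mul_fourier_neg_eq_zero hu fun k hk => ha k (by lia)) fun t => ?_
  · simpa only [v, ContinuousMap.mul_apply, norm_mul, norm_fourier_apply, mul_one] using
      (u.norm_coe_le_norm t).trans hu_le
  · simpa only [norm_mul, norm_fourier_apply, one_mul] using g.norm_coe_le_norm t

theorem norm_coeff_add_norm_tsum_mul_le {n : ℕ}
    (hu : HasSum (fun k : ℕ => a k • fourier (k : ℤ)) u)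
    (hg : HasSum (fun k : ℕ => b k • fourier (-k : ℤ)) g) (ha : ∀ k ≤ 2 * n, a k = 0)
    (hu_le : ‖u‖ ≤ 1 / 2) : ‖b n‖ + ‖∑' k, a k * b k‖ ≤ ‖g‖ := by
  obtain ⟨c, hc, hcb⟩ := Complex.exists_norm_eq_mul_self (b n)
  obtain ⟨d, hd, hds⟩ := Complex.exists_norm_eq_mul_self (∑' k, a k * b k)
  have h := norm_coeff_add_tsum_mul_le (n := n) (a := fun k => d / c * a k) (u := (d / c) • u)
    (by simpa only [mul_smul] using hu.const_smul (d / c)) hg (fun k hk => by simp [ha k hk])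
    (by simpa [norm_smul, hc, hd] using hu_le)
  simp only [mul_assoc, tsum_mul_left] at h
  have hc0 : c ≠ 0 := norm_ne_zero_iff.1 (by simp [hc])
  calc ‖b n‖ + ‖∑' k, a k * b k‖ = ‖c * (b n + d / c * ∑' k, a k * b k)‖ := by
        rw [mul_add, ← mul_assoc, mul_div_cancel₀ _ hc0, ← hcb, ← hds, ← Complex.ofReal_add,
          Complex.norm_real, Real.norm_of_nonneg (by positivity)]
    _ ≤ ‖g‖ := by rwa [norm_mul, hc, one_mul]

end

theorem exists_hasSum_taylorCoeff_smul_fourier {f : ℂ → ℂ}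
    (hf : DifferentiableOn ℂ f (Metric.ball 0 1)) {w : ℂ} (hw : ‖w‖ < 1) (s : ℤ) :
    ∃ u : C(AddCircle T, ℂ),
      HasSum (fun k : ℕ => (taylorCoeff f k * w ^ k) • fourier (T := T) (s * k)) u ∧
        ∀ t, u t = f (w * fourier s t) := by
  have hsum : Summable fun k : ℕ => (taylorCoeff f k * w ^ k) • fourier (T := T) (s * k) :=
    .of_norm (by simpa only [norm_smul, fourier_norm, mul_one] using
      (hasSum_taylorCoeff hf hw).summable.norm)
  refine ⟨_, hsum.hasSum, fun t => ?_⟩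
  have hwt : ‖w * fourier s t‖ < 1 := by rwa [norm_mul, norm_fourier_apply, mul_one]
  refine (ContinuousMap.hasSum_apply hsum.hasSum t).unique
    ((hasSum_taylorCoeff hf hwt).congr_fun fun k => ?_)
  rw [mul_pow, fourier_pow, ← mul_assoc]
  rfl

end Fourier

section Sufficiency

variable {L g : ℂ → ℂ} {n : ℕ}

theorem norm_taylorCoeff_mul_pow_add_norm_hadamardProd_le
    (hL : DifferentiableOn ℂ L (Metric.ball 0 1)) (hL_zero : ∀ k ≤ 2 * n, taylorCoeff L k = 0)
    (hL_le : ∀ z ∈ Metric.ball (0 : ℂ) 1, ‖L z‖ ≤ 1 / 2)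
    (hg : DifferentiableOn ℂ g (Metric.ball 0 1)) {M : ℝ}
    (hg_le : ∀ z ∈ Metric.ball (0 : ℂ) 1, ‖g z‖ ≤ M) {z : ℂ} {r : ℝ} (hzr : ‖z‖ < r)
    (hr : r < 1) : ‖taylorCoeff g n‖ * r ^ n + ‖hadamardProd L g z‖ ≤ M := by
  have hr0 : 0 < r := (norm_nonneg z).trans_lt hzr
  have hr_norm : ‖(r : ℂ)‖ < 1 := by rwa [Complex.norm_real, Real.norm_of_nonneg hr0.le]
  have hzr_norm : ‖z / r‖ < 1 := by
    rwa [norm_div, Complex.norm_real, Real.norm_of_nonneg hr0.le, div_lt_one hr0]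
  obtain ⟨u, hu, hu_apply⟩ :=
    exists_hasSum_taylorCoeff_smul_fourier (T := 1) hL hzr_norm 1
  obtain ⟨v, hv, hv_apply⟩ :=
    exists_hasSum_taylorCoeff_smul_fourier (T := 1) hg hr_norm (-1)
  simp only [one_mul, neg_one_mul] at hu hv
  have hmem {w : ℂ} (hw : ‖w‖ < 1) (s : ℤ) (t : UnitAddCircle) :
      w * fourier s t ∈ Metric.ball (0 : ℂ) 1 := by
    rwa [mem_ball_zero_iff, norm_mul, norm_fourier_apply, mul_one]
  have hu_le : ‖u‖ ≤ 1 / 2 := (u.norm_le (by norm_num)).2 fun t =>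
    hu_apply t ▸ hL_le _ (hmem hzr_norm 1 t)
  have hv_le : ‖v‖ ≤ M := by
    have hM : 0 ≤ M := (norm_nonneg _).trans (hg_le 0 (Metric.mem_ball_self one_pos))
    exact (v.norm_le hM).2 fun t => hv_apply t ▸ hg_le _ (hmem hr_norm (-1) t)
  have hprod : ∑' k, taylorCoeff L k * (z / r) ^ k * (taylorCoeff g k * (r : ℂ) ^ k) =
      hadamardProd L g z := by
    refine tsum_congr fun k => ?_
    rw [mul_mul_mul_comm, ← mul_pow, div_mul_cancel₀ z (Complex.ofReal_ne_zero.2 hr0.ne')]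
  have h := norm_coeff_add_norm_tsum_mul_le hu hv (n := n)
    (fun k hk => by rw [hL_zero k hk, zero_mul]) hu_le
  rw [hprod, norm_mul, norm_pow, Complex.norm_real, Real.norm_of_nonneg hr0.le] at h
  exact h.trans hv_le

theorem norm_taylorCoeff_add_norm_hadamardProd_le
    (hL : DifferentiableOn ℂ L (Metric.ball 0 1)) (hL_zero : ∀ k ≤ 2 * n, taylorCoeff L k = 0)
    (hL_le : ∀ z ∈ Metric.ball (0 : ℂ) 1, ‖L z‖ ≤ 1 / 2)
    (hg : DifferentiableOn ℂ g (Metric.ball 0 1)) {M : ℝ}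
    (hg_le : ∀ z ∈ Metric.ball (0 : ℂ) 1, ‖g z‖ ≤ M) {z : ℂ} (hz : z ∈ Metric.ball 0 1) :
    ‖taylorCoeff g n‖ + ‖hadamardProd L g z‖ ≤ M := by
  have hlim : Tendsto (fun r : ℝ => ‖taylorCoeff g n‖ * r ^ n + ‖hadamardProd L g z‖) (𝓝[<] 1)
      (𝓝 (‖taylorCoeff g n‖ * 1 ^ n + ‖hadamardProd L g z‖)) :=
    tendsto_nhdsWithin_of_tendsto_nhds (Continuous.tendsto (by fun_prop) 1)
  rw [one_pow, mul_one] at hlim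
  refine le_of_tendsto hlim ?_
  filter_upwards [Ioo_mem_nhdsLT (mem_ball_zero_iff.1 hz)] with r hr
  exact norm_taylorCoeff_mul_pow_add_norm_hadamardProd_le hL hL_zero hL_le hg hg_le hr.1 hr.2

theorem hadamardProd_sub_polynomial_eval (hL_zero : ∀ k < n, taylorCoeff L k = 0)
    (hg : DifferentiableOn ℂ g (Metric.ball 0 1)) {p : ℂ[X]} (hp : p ∈ degreeLT ℂ n) :
    hadamardProd L (fun z => g z - p.eval z) = hadamardProd L g := by
  refine funext fun z => tsum_congr fun k => ?_
  obtain hk | hk := lt_or_ge k n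
  · simp only [hL_zero k hk, zero_mul]
  · rw [taylorCoeff_sub_polynomial_eval hg, coeff_eq_zero_of_degree_lt
      ((mem_degreeLT.1 hp).trans_le (by exact_mod_cast hk)), sub_zero]

theorem enorm_taylorCoeff_add_discSupNorm_hadamardProd_le_bestApprox
    (hL : DifferentiableOn ℂ L (Metric.ball 0 1)) (hL_zero : ∀ k ≤ 2 * n, taylorCoeff L k = 0)
    (hL_le : ∀ z ∈ Metric.ball (0 : ℂ) 1, ‖L z‖ ≤ 1 / 2)
    (hg : DifferentiableOn ℂ g (Metric.ball 0 1)) :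
    ‖taylorCoeff g n‖ₑ + discSupNorm (hadamardProd L g) ≤ bestApprox n g := by
  refine le_iInf₂ fun p hp => ?_
  obtain htop | htop := eq_or_ne (discSupNorm fun z => g z - p.eval z) ∞
  · exact htop ▸ le_top
  have hcoeff : taylorCoeff (fun z => g z - p.eval z) n = taylorCoeff g n := by
    rw [taylorCoeff_sub_polynomial_eval hg, coeff_eq_zero_of_degree_lt (mem_degreeLT.1 hp),
      sub_zero]
  rw [← ENNReal.ofReal_toReal htop, enorm_add_discSupNorm_le_ofReal_iff ENNReal.toReal_nonneg,
    ← hcoeff, ← hadamardProd_sub_polynomial_eval (fun k hk => hL_zero k (by lia)) hg hp]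
  exact fun z hz => norm_taylorCoeff_add_norm_hadamardProd_le hL hL_zero hL_le
    (hg.sub p.differentiable.differentiableOn)
    ((discSupNorm_le_ofReal_iff ENNReal.toReal_nonneg).1 (ENNReal.ofReal_toReal htop).ge) hz

end Sufficiency

section BlaschkeFactor

variable {a : ℂ}

/-- The Blaschke factor of the unit disc with its zero at `a`, normalised without a unimodular
constant; it supplies the extremal functions. -/
noncomputable def blaschkeFactor (a z : ℂ) : ℂ :=
  (z - a) / (1 - conj a * z)

theorem norm_conj_mul_lt_one (ha : ‖a‖ < 1) {z : ℂ} (hz : ‖z‖ < 1) : ‖conj a * z‖ < 1 := by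
  rw [norm_mul, RCLike.norm_conj]
  exact mul_lt_one_of_nonneg_of_lt_one_left (norm_nonneg a) ha hz.le

theorem one_sub_conj_mul_ne_zero (ha : ‖a‖ < 1) {z : ℂ} (hz : ‖z‖ < 1) : 1 - conj a * z ≠ 0 :=
  sub_ne_zero.2 fun h => (norm_conj_mul_lt_one ha hz).ne (by rw [← h, norm_one])

theorem norm_one_sub_norm_sq (ha : ‖a‖ < 1) : ‖(1 - ‖a‖ ^ 2 : ℂ)‖ = 1 - ‖a‖ ^ 2 := by
  rw [← Complex.ofReal_one, ← Complex.ofReal_pow, ← Complex.ofReal_sub, Complex.norm_real,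
    Real.norm_of_nonneg (sub_nonneg.2 (pow_le_one₀ (norm_nonneg a) ha.le))]

theorem hasSum_blaschkeFactor (ha : ‖a‖ < 1) {z : ℂ} (hz : ‖z‖ < 1) :
    HasSum (fun k : ℕ =>
        (k.casesOn (-a) fun i => (1 - ‖a‖ ^ 2 : ℂ) * conj a ^ i : ℂ) * z ^ k)
      (blaschkeFactor a z) := by
  have hsplit : (1 - ‖a‖ ^ 2 : ℂ) * z * (1 - conj a * z)⁻¹ = blaschkeFactor a z - -a := by
    have h0 := one_sub_conj_mul_ne_zero ha hz
    rw [blaschkeFactor, ← Complex.mul_conj']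
    field_simp
    ring
  rw [← hasSum_nat_add_iff' 1, Finset.sum_range_one, pow_zero, mul_one]
  change HasSum _ (blaschkeFactor a z - -a)
  rw [← hsplit]
  refine ((hasSum_geometric_of_norm_lt_one (norm_conj_mul_lt_one ha hz)).mul_left _).congr_fun
    fun i => ?_
  rw [mul_pow]
  ring

theorem differentiableOn_blaschkeFactor (ha : ‖a‖ < 1) :
    DifferentiableOn ℂ (blaschkeFactor a) (Metric.ball 0 1) :=
  differentiableOn_of_hasSum fun _ => hasSum_blaschkeFactor ha

theorem taylorCoeff_blaschkeFactor_zero (a : ℂ) : taylorCoeff (blaschkeFactor a) 0 = -a := by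
  simp [taylorCoeff_zero, blaschkeFactor]

theorem taylorCoeff_blaschkeFactor_succ (ha : ‖a‖ < 1) (i : ℕ) :
    taylorCoeff (blaschkeFactor a) (i + 1) = (1 - ‖a‖ ^ 2) * conj a ^ i :=
  taylorCoeff_eq_of_hasSum (fun _ => hasSum_blaschkeFactor ha) (i + 1)

theorem norm_taylorCoeff_blaschkeFactor_succ (ha : ‖a‖ < 1) (i : ℕ) :
    ‖taylorCoeff (blaschkeFactor a) (i + 1)‖ = (1 - ‖a‖ ^ 2) * ‖a‖ ^ i := by
  rw [taylorCoeff_blaschkeFactor_succ ha, norm_mul, norm_one_sub_norm_sq ha, norm_pow,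
    RCLike.norm_conj]

theorem norm_blaschkeFactor_le_one (ha : ‖a‖ < 1) {z : ℂ} (hz : z ∈ Metric.ball 0 1) :
    ‖blaschkeFactor a z‖ ≤ 1 := by
  rw [mem_ball_zero_iff] at hz
  have hdiff : ‖1 - conj a * z‖ ^ 2 - ‖z - a‖ ^ 2 = (1 - ‖a‖ ^ 2) * (1 - ‖z‖ ^ 2) := by
    simp only [Complex.sq_norm, Complex.normSq_apply, Complex.sub_re, Complex.sub_im,
      Complex.mul_re, Complex.mul_im, Complex.conj_re, Complex.conj_im, Complex.one_re,
      Complex.one_im]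
    ring
  have hnonneg : 0 ≤ (1 - ‖a‖ ^ 2) * (1 - ‖z‖ ^ 2) :=
    mul_nonneg (sub_nonneg.2 (pow_le_one₀ (norm_nonneg a) ha.le))
      (sub_nonneg.2 (pow_le_one₀ (norm_nonneg z) hz.le))
  rw [blaschkeFactor, norm_div,
    div_le_one (norm_pos_iff.2 (one_sub_conj_mul_ne_zero ha hz))]
  exact le_of_sq_le_sq (by linarith) (norm_nonneg _)

end BlaschkeFactor

/-- The inequality of the theorem with `‖f‖_∞` in place of the best approximation, normalised to
the unit ball of `H^∞` and written pointwise. -/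
def IsHadamardContraction (n : ℕ) (L : ℂ → ℂ) : Prop :=
  ∀ f : ℂ → ℂ, DifferentiableOn ℂ f (Metric.ball 0 1) →
    (∀ z ∈ Metric.ball (0 : ℂ) 1, ‖f z‖ ≤ 1) →
      ∀ z ∈ Metric.ball (0 : ℂ) 1, ‖taylorCoeff f n‖ + ‖hadamardProd L f z‖ ≤ 1

section Necessity

variable {n : ℕ} {L f : ℂ → ℂ}

theorem IsHadamardContraction.norm_taylorCoeff_add_norm_mul_le (h : IsHadamardContraction n L)
    (hL : DifferentiableOn ℂ L (Metric.ball 0 1)) (hf : DifferentiableOn ℂ f (Metric.ball 0 1))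
    (hf_le : ∀ z ∈ Metric.ball (0 : ℂ) 1, ‖f z‖ ≤ 1) (k : ℕ) :
    ‖taylorCoeff f n‖ + ‖taylorCoeff L k * taylorCoeff f k‖ ≤ 1 := by
  rw [← taylorCoeff_hadamardProd hL hf, ← le_sub_iff_add_le']
  exact norm_taylorCoeff_le (differentiableOn_hadamardProd hL hf)
    (fun z hz => le_sub_iff_add_le'.2 (h f hf hf_le z hz)) k

theorem IsHadamardContraction.norm_taylorCoeff_add_norm_mul_le_of_comp_pow
    (h : IsHadamardContraction n L)
    (hL : DifferentiableOn ℂ L (Metric.ball 0 1)) (hf : DifferentiableOn ℂ f (Metric.ball 0 1))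
    (hf_le : ∀ z ∈ Metric.ball (0 : ℂ) 1, ‖f z‖ ≤ 1) {m j i : ℕ} (hj : j ≠ 0)
    (hn : m + j * i = n) (k : ℕ) :
    ‖taylorCoeff f i‖ + ‖taylorCoeff L (m + j * k) * taylorCoeff f k‖ ≤ 1 := by
  have hmaps : MapsTo (fun z : ℂ => z ^ j) (Metric.ball 0 1) (Metric.ball 0 1) := fun z hz => by
    rw [mem_ball_zero_iff] at hz ⊢
    simpa using pow_lt_one₀ (norm_nonneg z) hz hj
  have hbound := h.norm_taylorCoeff_add_norm_mul_le hL (f := fun z => z ^ m * f (z ^ j))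
    ((differentiable_pow m).differentiableOn.mul
      (hf.comp (differentiable_pow j).differentiableOn hmaps)) (fun z hz => ?_) (m + j * k)
  · rwa [← hn, taylorCoeff_pow_mul_comp_pow hf m hj, taylorCoeff_pow_mul_comp_pow hf m hj] at hbound
  · rw [norm_mul, norm_pow]
    exact mul_le_one₀ (pow_le_one₀ (norm_nonneg z) (mem_ball_zero_iff.1 hz).le) (norm_nonneg _)
      (hf_le _ (hmaps hz))

theorem IsHadamardContraction.taylorCoeff_self_eq_zero (h : IsHadamardContraction n L)
    (hL : DifferentiableOn ℂ L (Metric.ball 0 1)) : taylorCoeff L n = 0 := by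
  have hbound := h.norm_taylorCoeff_add_norm_mul_le_of_comp_pow hL (f := fun _ => 1) (m := n)
    (differentiableOn_const 1) (by simp) one_ne_zero (by rw [mul_zero, add_zero]) 0
  simpa [taylorCoeff_zero] using hbound

-- Let `t → 0⁺` in `z ^ m * blaschkeFactor t (z ^ j)`: its coefficient at `n` falls short of `1`
-- only to second order in `t`, while those at `n - j` and `n + j` are of first order.
theorem IsHadamardContraction.taylorCoeff_add_mul_eq_zero (h : IsHadamardContraction n L)
    (hL : DifferentiableOn ℂ L (Metric.ball 0 1)) {m j k : ℕ} (hj : j ≠ 0) (hn : m + j = n)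
    (hk : k = 0 ∨ k = 2) : taylorCoeff L (m + j * k) = 0 := by
  have hlim : Tendsto (fun t : ℝ => ‖taylorCoeff L (m + j * k)‖ * (1 - t ^ 2) - t) (𝓝[>] 0)
      (𝓝 (‖taylorCoeff L (m + j * k)‖ * (1 - 0 ^ 2) - 0)) :=
    tendsto_nhdsWithin_of_tendsto_nhds (Continuous.tendsto (by fun_prop) 0)
  suffices ‖taylorCoeff L (m + j * k)‖ * (1 - 0 ^ 2) - 0 ≤ 0 by simpa using this
  refine le_of_tendsto hlim ?_
  filter_upwards [Ioo_mem_nhdsGT (zero_lt_one' ℝ)] with t ⟨ht0, ht1⟩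
  have ht_norm : ‖(t : ℂ)‖ = t := by rw [Complex.norm_real, Real.norm_of_nonneg ht0.le]
  have ha : ‖(t : ℂ)‖ < 1 := ht_norm.trans_lt ht1
  have hcoeff : (1 - t ^ 2) * t ≤ ‖taylorCoeff (blaschkeFactor t) k‖ := by
    obtain rfl | rfl := hk
    · rw [taylorCoeff_blaschkeFactor_zero, norm_neg, ht_norm]
      exact mul_le_of_le_one_left ht0.le (sub_le_self 1 (sq_nonneg t))
    · rw [norm_taylorCoeff_blaschkeFactor_succ ha, ht_norm, pow_one]
  have hbound := h.norm_taylorCoeff_add_norm_mul_le_of_comp_pow hL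
    (differentiableOn_blaschkeFactor ha) (fun z => norm_blaschkeFactor_le_one ha) (i := 1) hj
    (by rw [mul_one, hn]) k
  rw [norm_taylorCoeff_blaschkeFactor_succ ha, pow_zero, mul_one, ht_norm, norm_mul] at hbound
  have hmul := mul_le_mul_of_nonneg_left hcoeff (norm_nonneg (taylorCoeff L (m + j * k)))
  refine sub_nonpos.2 (le_of_mul_le_mul_right ?_ ht0)
  linarith

theorem IsHadamardContraction.taylorCoeff_eq_zero (h : IsHadamardContraction n L)
    (hL : DifferentiableOn ℂ L (Metric.ball 0 1)) {k : ℕ} (hk : k ≤ 2 * n) :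
    taylorCoeff L k = 0 := by
  obtain hlt | rfl | hgt := lt_trichotomy k n
  · simpa using h.taylorCoeff_add_mul_eq_zero hL (m := k) (j := n - k) (k := 0) (by lia) (by lia)
      (.inl rfl)
  · exact h.taylorCoeff_self_eq_zero hL
  · have := h.taylorCoeff_add_mul_eq_zero hL (m := 2 * n - k) (j := k - n) (k := 2) (by lia)
      (by lia) (.inr rfl)
    rwa [show 2 * n - k + (k - n) * 2 = k by lia] at this

theorem conj_pow_mul_hadamardProd_pow_mul_blaschkeFactor
    (hL : DifferentiableOn ℂ L (Metric.ball 0 1)) (hL_zero : ∀ k ≤ n, taylorCoeff L k = 0)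
    {a z : ℂ} (ha : ‖a‖ < 1) (hz : ‖z‖ < 1) :
    conj a ^ (n + 1) * hadamardProd L (fun z => z ^ n * blaschkeFactor a z) z =
      (1 - ‖a‖ ^ 2) * L (conj a * z) := by
  rw [hadamardProd, ← (hasSum_taylorCoeff hL (norm_conj_mul_lt_one ha hz)).tsum_eq,
    ← tsum_mul_left, ← tsum_mul_left]
  refine tsum_congr fun k => ?_
  obtain hk | hk := le_or_gt k n
  · simp only [hL_zero k hk, zero_mul, mul_zero]
  obtain ⟨i, rfl⟩ := Nat.exists_eq_add_of_lt hk
  have hcoeff := taylorCoeff_pow_mul_comp_pow (differentiableOn_blaschkeFactor ha) n one_ne_zero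
    (i + 1)
  simp only [pow_one, one_mul, ← add_assoc, taylorCoeff_blaschkeFactor_succ ha] at hcoeff
  rw [hcoeff]
  ring

theorem IsHadamardContraction.one_add_norm_mul_norm_le (h : IsHadamardContraction n L)
    (hL : DifferentiableOn ℂ L (Metric.ball 0 1)) {a z : ℂ} (ha : ‖a‖ < 1)
    (hz : z ∈ Metric.ball 0 1) : (1 + ‖a‖) * ‖L (conj a * z)‖ ≤ 1 := by
  let f : ℂ → ℂ := fun z => z ^ n * blaschkeFactor a z
  have hf : DifferentiableOn ℂ f (Metric.ball 0 1) :=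
    (differentiable_pow n).differentiableOn.mul (differentiableOn_blaschkeFactor ha)
  have hf_le (w : ℂ) (hw : w ∈ Metric.ball 0 1) : ‖f w‖ ≤ 1 := by
    rw [norm_mul, norm_pow]
    exact mul_le_one₀ (pow_le_one₀ (norm_nonneg w) (mem_ball_zero_iff.1 hw).le) (norm_nonneg _)
      (norm_blaschkeFactor_le_one ha hw)
  have hf_coeff : ‖taylorCoeff f n‖ = ‖a‖ := by
    simpa [taylorCoeff_blaschkeFactor_zero] using congrArg norm
      (taylorCoeff_pow_mul_comp_pow (differentiableOn_blaschkeFactor ha) n one_ne_zero 0)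
  have hprod : ‖a‖ ^ (n + 1) * ‖hadamardProd L f z‖ = (1 - ‖a‖ ^ 2) * ‖L (conj a * z)‖ := by
    simpa only [norm_mul, norm_pow, RCLike.norm_conj, norm_one_sub_norm_sq ha] using congrArg norm
      (conj_pow_mul_hadamardProd_pow_mul_blaschkeFactor hL
        (fun k hk => h.taylorCoeff_eq_zero hL (by lia : k ≤ 2 * n)) ha (mem_ball_zero_iff.1 hz))
  have hle : ‖hadamardProd L f z‖ ≤ 1 - ‖a‖ := by
    simpa only [hf_coeff, le_sub_iff_add_le'] using h f hf hf_le z hz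
  refine le_of_mul_le_mul_left ?_ (sub_pos.2 ha)
  calc (1 - ‖a‖) * ((1 + ‖a‖) * ‖L (conj a * z)‖)
      = ‖a‖ ^ (n + 1) * ‖hadamardProd L f z‖ := by rw [hprod]; ring
    _ ≤ 1 * (1 - ‖a‖) := mul_le_mul (pow_le_one₀ (norm_nonneg a) ha.le) hle (norm_nonneg _)
        zero_le_one
    _ = (1 - ‖a‖) * 1 := mul_comm _ _

theorem IsHadamardContraction.norm_le_half (h : IsHadamardContraction n L)
    (hL : DifferentiableOn ℂ L (Metric.ball 0 1)) {w : ℂ} (hw : w ∈ Metric.ball 0 1) :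
    ‖L w‖ ≤ 1 / 2 := by
  have hlim : Tendsto (fun t : ℝ => (1 + t) * ‖L w‖) (𝓝[<] 1) (𝓝 ((1 + 1) * ‖L w‖)) :=
    tendsto_nhdsWithin_of_tendsto_nhds (Continuous.tendsto (by fun_prop) 1)
  suffices (1 + 1) * ‖L w‖ ≤ 1 by linarith
  refine le_of_tendsto hlim ?_
  filter_upwards [Ioo_mem_nhdsLT (mem_ball_zero_iff.1 hw)] with t ht
  have ht0 : 0 < t := (norm_nonneg w).trans_lt ht.1
  have ht_norm : ‖(t : ℂ)‖ = t := by rw [Complex.norm_real, Real.norm_of_nonneg ht0.le]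
  have hmem : w / t ∈ Metric.ball 0 1 := by
    rw [mem_ball_zero_iff, norm_div, ht_norm]
    exact (div_lt_one ht0).2 ht.1
  simpa only [ht_norm, Complex.conj_ofReal, mul_div_cancel₀ w (Complex.ofReal_ne_zero.2 ht0.ne')]
    using h.one_add_norm_mul_norm_le hL (ht_norm.trans_lt ht.2) hmem

end Necessity

theorem theorem3_general (n : ℕ) (L : ℂ → ℂ)
    (hL : DifferentiableOn ℂ L (Metric.ball (0 : ℂ) 1)) :
    List.TFAE [
      ∀ f : ℂ → ℂ, IsHInfty f →
        ‖taylorCoeff f n‖ₑ + discSupNorm (hadamardProd L f) ≤ bestApprox n f,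
      ∀ f : ℂ → ℂ, IsHInfty f →
        ‖taylorCoeff f n‖ₑ + discSupNorm (hadamardProd L f) ≤ discSupNorm f,
      ∀ z ∈ Metric.ball (0 : ℂ) 1, ‖L z‖ ≤ (1 / 2 : ℝ) * ‖z‖ ^ (2 * n + 1)] := by
  tfae_have 1 → 2 := fun h f hf => (h f hf).trans (bestApprox_le_discSupNorm n f)
  tfae_have 2 → 3 := fun h z hz => by
    have hcontr : IsHadamardContraction n L := fun f hf hf_le => by
      rw [← discSupNorm_le_ofReal_iff zero_le_one] at hf_le
      exact (enorm_add_discSupNorm_le_ofReal_iff zero_le_one).1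
        ((h f ⟨hf, hf_le.trans_lt ENNReal.ofReal_lt_top⟩).trans hf_le)
    exact norm_le_mul_pow_of_taylorCoeff_eq_zero hL (fun w => hcontr.norm_le_half hL)
      (fun k hk => hcontr.taylorCoeff_eq_zero hL (Nat.lt_succ_iff.1 hk)) hz
  tfae_have 3 → 1 := fun h f hf =>
    enorm_taylorCoeff_add_discSupNorm_hadamardProd_le_bestApprox hL
      (fun k hk => taylorCoeff_eq_zero_of_norm_le_mul_pow hL h (Nat.lt_succ_of_le hk))
      (fun z hz => (h z hz).trans (mul_le_of_le_one_right (by norm_num)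
        (pow_le_one₀ (norm_nonneg z) (mem_ball_zero_iff.1 hz).le))) hf.1
  tfae_finish

theorem theorem3 (n : ℕ) (L : ℂ → ℂ)
    (hL : DifferentiableOn ℂ L (Metric.ball (0 : ℂ) 1))
    (hL0 : L =O[𝓝 0] fun z : ℂ => z ^ n) :
    (∀ f : ℂ → ℂ, IsHInfty f →
        ‖taylorCoeff f n‖ₑ + discSupNorm (hadamardProd L f) ≤ bestApprox n f) ↔
      ∀ z ∈ Metric.ball (0 : ℂ) 1, ‖L z‖ ≤ (1 / 2 : ℝ) * ‖z‖ ^ (2 * n + 1) :=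
  (theorem3_general n L hL).out 0 2
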